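/- **Conventions.** All Hilbert spaces are complex, with inner product $(\cdot,\cdot)$ linear in the first argument. A linear relation in $\mathfrak H$ is a linear subspace $T\subset\mathfrak H\oplus\mathfrak H$; operators are identified with their graphs, and $T^*=\{\{g,g'\}: (f',g)=(f,g')\ \text{for all } \{f,f'\}\in T\}$. Write $\ker(T-z)=\{f:\{f,zf\}\in T\}$ and $\operatorname{ran}(T-z)=\{f'-zf:\{f,f'\}\in T\}$. For closed $T$, $z\in\rho(T)$ means $\ker(T-z)=\{0\}$ and $\operatorname{ran}(T-z)=\mathfrak H$; $z\in\widehat\rho(T)$ ($z$ is a regular type point) means $\ker(T-z)=\{0\}$ and $\operatorname{ran}(T-z)$ is closed and $\neq\mathfrak H$. A closed operator $A$ is symmetric if $A\subset A^*$; it is simple if there is no decomposition $\mathfrak H=\mathfrak H'\oplus\mathfrak H''$ (orthogonal), $A=A'\oplus A''$ with $\mathfrak H'\ne\{0\}$, $A'$ a self-adjoint operator in $\mathfrak H'$ and $A''$ a symmetric operator in $\mathfrak H''$. Let $A$ be a closed symmetric operator in $\mathfrak H$. A boundary triplet $\Pi=\{\mathcal H\oplus\mathcal H,\Gamma,\Gamma^\top\}$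 for the dual pair $\{A,A\}$ consists of a Hilbert space $\mathcal H$ and surjective linear maps $\Gamma=(\Gamma_0,\Gamma_1)$, $\Gamma^\top=(\Gamma_0^\top,\Gamma_1^\top)$ from $A^*$ onto $\mathcal H\oplus\mathcal H$ such that $$(f',g)-(f,g')=(\Gamma_1\hat f,\Gamma_0^\top\hat g)-(\Gamma_0\hat f,\Gamma_1^\top\hat g),\qquad \hat f=\{f,f'\},\ \hat g=\{g,g'\}\in A^*.$$ Put $A_0=\ker\Gamma_0$. The Weyl function $M_\Pi$ of $\Pi$ assigns to each $z\in\rho(A_0)$ the unique bounded operator $M_\Pi(z)$ in $\mathcal H$ with $\Gamma_1\{f,zf\}=M_\Pi(z)\Gamma_0\{f,zf\}$ for all $f\in\ker(A^*-z)$. For $\lambda_0\in\mathbb R$, $\Pi$ belongs to the class $BT_{\lambda_0}$ if $\lambda_0\in\rho(A_0)$ and $\Gamma_0\{f,\lambda_0f\}=\Gamma_0^\top\{f,\lambda_0f\}$ for all $f\in\ker(A^*-\lambda_0)$. Boundary triplets $\Pi_j=\{\mathcal H\oplus\mathcal H,\Gamma^{(j)},\Gamma^{\top(j)}\}$ for $\{A^{(j)},A^{(j)}\}$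 in $\mathfrak H_j$, $j=1,2$, are unitarily equivalent if there is a unitary operator $U$ from $\mathfrak H_1$ onto $\mathfrak H_2$ such that, with $\widetilde U=U\oplus U$, $$\widetilde U A^{(1)*}=A^{(2)*}\quad\text{and}\quad \Gamma^{(2)}\widetilde U\upharpoonright A^{(1)*}=\Gamma^{(1)}.$$ **Theorem 4.6.** Let $\mathfrak H_1,\mathfrak H_2,\mathcal H$ be Hilbert spaces. For $j=1,2$ let $A^{(j)}$ be a closed, not necessarily bounded or densely defined, simple symmetric operator in $\mathfrak H_j$, let $\lambda_0\in\mathbb R$ satisfy $\lambda_0\in\widehat\rho(A^{(1)})\cap\widehat\rho(A^{(2)})$, and let $\Pi_j=\{\mathcal H\oplus\mathcal H,\Gamma^{(j)},\Gamma^{\top(j)}\}\in BT_{\lambda_0}$ be a boundary triplet for $\{A^{(j)},A^{(j)}\}$ with Weyl function $M_{\Pi_j}$. If for some $\varepsilon>0$ $$M_{\Pi_1}(z)=M_{\Pi_2}(z)\quad\text{for all } z \text{ with } |z-\lambda_0|<\varepsilon \text{ at which both sides are defined},$$ then $\Pi_1$ and $\Pi_2$ are unitarily equivalent. -/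

import Mathlib

open Filter Topology

noncomputable section

/-! ### Linear relations

A linear relation in a Hilbert space `E` is a submodule of `E × E`; an operator is identified with
its graph, and the adjoint relation is `Submodule.adjoint`. -/

namespace LinRel

section

variable {E : Type*} [NormedAddCommGroup E] [InnerProductSpace ℂ E]

/-- `ker (T - z) = {f | {f, z f} ∈ T}`. -/
def kerSub (T : Submodule ℂ (E × E)) (z : ℂ) : Submodule ℂ E :=
  T.comap (LinearMap.prod LinearMap.id (z • LinearMap.id))

/-- `ran (T - z) = {f' - z f | {f, f'} ∈ T}`. -/
def ranSub (T : Submodule ℂ (E × E)) (z : ℂ) : Submodule ℂ E :=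
  T.map (LinearMap.snd ℂ E E - z • LinearMap.fst ℂ E E)

/-- The resolvent set `ρ(T)` of a closed linear relation. -/
def resolventSet (T : Submodule ℂ (E × E)) : Set ℂ :=
  {z | kerSub T z = ⊥ ∧ ranSub T z = ⊤}

/-- The set of regular type points of a closed linear relation: `T - z` is injective
and its range is closed and not the whole space. -/
def regularTypePoints (T : Submodule ℂ (E × E)) : Set ℂ :=
  {z | kerSub T z = ⊥ ∧ IsClosed (ranSub T z : Set E) ∧ ranSub T z ≠ ⊤}

/-- `T` is symmetric: `T ⊆ T*`. -/
def IsSymm (T : Submodule ℂ (E × E)) : Prop := T ≤ T.adjoint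

/-- `T` is self-adjoint: `T = T*`. -/
def IsSelfAdj (T : Submodule ℂ (E × E)) : Prop := T = T.adjoint

/-- A relation in the subspace `K`, regarded as a relation in `E`. -/
def lift {K : Submodule ℂ E} (T : Submodule ℂ (K × K)) : Submodule ℂ (E × E) :=
  T.map (LinearMap.prodMap K.subtype K.subtype)

/-- The operator `A` is simple: there is no decomposition `E = K ⊕ Kᗮ`, `A = A₁ ⊕ A₂` with
`K ≠ {0}`, `A₁` a self-adjoint operator in `K`, and `A₂` a symmetric operator in `Kᗮ`. -/
def IsSimple (A : E →ₗ.[ℂ] E) : Prop :=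
  ¬ ∃ (K : Submodule ℂ E) (A₁ : K →ₗ.[ℂ] K) (A₂ : Kᗮ →ₗ.[ℂ] Kᗮ),
      IsClosed (K : Set E) ∧ K ≠ ⊥ ∧ IsSelfAdj A₁.graph ∧ IsSymm A₂.graph ∧
        A.graph = lift A₁.graph ⊔ lift A₂.graph

theorem isClosed_adjoint (T : Submodule ℂ (E × E)) : IsClosed (T.adjoint : Set (E × E)) := by
  have h : (T.adjoint : Set (E × E)) =
      ⋂ p : T, {x : E × E | inner ℂ p.1.2 x.1 - inner ℂ p.1.1 x.2 = 0} := by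
    ext x
    simp [Submodule.mem_adjoint_iff]
  rw [h]
  exact isClosed_iInter fun p => isClosed_eq (by fun_prop) continuous_const

end

end LinRel

/-! ### Boundary triplets for the dual pair `{A, A}` -/

/-- A boundary triplet `{H ⊕ H, Γ, Γᵀ}` for `{A, A}`, where `Γ = (Γ₀, Γ₁)`, `Γᵀ = (Γt₀, Γt₁)` are
linear maps on the relation `A* = A.graph.adjoint`. (The inner product
`(x, y)`, linear in `x`, is `inner ℂ y x`.) -/
structure BoundaryTriplet {E : Type*} [NormedAddCommGroup E] [InnerProductSpace ℂ E]
    (A : E →ₗ.[ℂ] E) (H : Type*) [NormedAddCommGroup H] [InnerProductSpace ℂ H] where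
  Γ₀ : A.graph.adjoint →ₗ[ℂ] H
  Γ₁ : A.graph.adjoint →ₗ[ℂ] H
  Γt₀ : A.graph.adjoint →ₗ[ℂ] H
  Γt₁ : A.graph.adjoint →ₗ[ℂ] H
  surj : Function.Surjective fun f => (Γ₀ f, Γ₁ f)
  surj_t : Function.Surjective fun f => (Γt₀ f, Γt₁ f)
  /-- `(f', g) - (f, g') = (Γ₁ f, Γᵀ₀ g) - (Γ₀ f, Γᵀ₁ g)` -/
  green : ∀ f g : A.graph.adjoint,
    inner ℂ g.1.1 f.1.2 - inner ℂ g.1.2 f.1.1 =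
      inner ℂ (Γt₀ g) (Γ₁ f) - inner ℂ (Γt₁ g) (Γ₀ f)

namespace BoundaryTriplet

section

variable {E : Type*} [NormedAddCommGroup E] [InnerProductSpace ℂ E] {A : E →ₗ.[ℂ] E}
  {H : Type*} [NormedAddCommGroup H] [InnerProductSpace ℂ H]

/-- The extension `A₀ = ker Γ₀`, a linear relation in `E`. -/
def A₀ (P : BoundaryTriplet A H) : Submodule ℂ (E × E) :=
  (LinearMap.ker P.Γ₀).map A.graph.adjoint.subtype

/-- The defect subspace `N_z = ker (A* - z)`. -/
def defect (A : E →ₗ.[ℂ] E) (z : ℂ) : Submodule ℂ E := LinRel.kerSub A.graph.adjoint z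

/-- The map `f ↦ {f, z f}` from `N_z` to `A*`. -/
def hat (A : E →ₗ.[ℂ] E) (z : ℂ) : defect A z →ₗ[ℂ] A.graph.adjoint :=
  LinearMap.codRestrict A.graph.adjoint
    (LinearMap.prod LinearMap.id (z • LinearMap.id) ∘ₗ (defect A z).subtype) fun f => f.2

/-- The class `BT_{l₀}`: `l₀ ∈ ρ(A₀)` and `Γ₀ {f, l₀ f} = Γᵀ₀ {f, l₀ f}` for `f ∈ ker (A* - l₀)`. -/
def IsBT (P : BoundaryTriplet A H) (l₀ : ℝ) : Prop :=
  (l₀ : ℂ) ∈ LinRel.resolventSet P.A₀ ∧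
    ∀ f : defect A l₀, P.Γ₀ (hat A l₀ f) = P.Γt₀ (hat A l₀ f)

theorem continuous_hat (A : E →ₗ.[ℂ] E) (z : ℂ) : Continuous (hat A z) :=
  Continuous.subtype_mk (continuous_subtype_val.prodMk (continuous_subtype_val.const_smul z)) _

theorem mem_A₀ (P : BoundaryTriplet A H) (f : A.graph.adjoint) :
    (f : E × E) ∈ P.A₀ ↔ P.Γ₀ f = 0 := by
  simp [A₀]

/-- For `z ∈ ρ(A₀)`, the map `f ↦ Γ₀ {f, z f}` from `N_z` to `H` is bijective. -/
theorem bijective_Γ₀ (P : BoundaryTriplet A H) {z : ℂ} (hz : z ∈ LinRel.resolventSet P.A₀) :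
    Function.Bijective (P.Γ₀ ∘ₗ hat A z) := by
  obtain ⟨hk, hr⟩ := hz
  constructor
  · rw [injective_iff_map_eq_zero]
    intro f h0
    have h1 : (hat A z f : E × E) ∈ P.A₀ := (P.mem_A₀ _).2 h0
    have h3 : f.1 ∈ LinRel.kerSub P.A₀ z := h1
    rw [hk, Submodule.mem_bot] at h3
    exact Subtype.ext h3
  · intro y
    obtain ⟨f, hf⟩ := P.surj (y, 0)
    have hf0 : P.Γ₀ f = y := congrArg Prod.fst hf
    have hm : f.1.2 - z • f.1.1 ∈ LinRel.ranSub P.A₀ z := by rw [hr]; trivial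
    obtain ⟨g', hg, hgf⟩ := hm
    obtain ⟨g, hg0, rfl⟩ := hg
    have hg0' : P.Γ₀ g = 0 := hg0
    have hgf' : g.1.2 - z • g.1.1 = f.1.2 - z • f.1.1 := hgf
    have e : ((f - g : A.graph.adjoint) : E × E) = (f.1.1 - g.1.1, z • (f.1.1 - g.1.1)) := by
      refine Prod.ext rfl ?_
      change f.1.2 - g.1.2 = z • (f.1.1 - g.1.1)
      have e : f.1.2 - g.1.2 - (z • f.1.1 - z • g.1.1) =
          (f.1.2 - z • f.1.1) - (g.1.2 - z • g.1.1) := by abel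
      rw [smul_sub, ← sub_eq_zero, e, hgf', sub_self]
    have hmem : f.1.1 - g.1.1 ∈ defect A z := by
      change (f.1.1 - g.1.1, z • (f.1.1 - g.1.1)) ∈ A.graph.adjoint
      rw [← e]
      exact (f - g).2
    refine ⟨⟨f.1.1 - g.1.1, hmem⟩, ?_⟩
    have e' : hat A z ⟨f.1.1 - g.1.1, hmem⟩ = f - g := Subtype.ext e.symm
    rw [LinearMap.comp_apply, e', map_sub, hf0, hg0', sub_zero]

variable [CompleteSpace E] [CompleteSpace H]

instance : CompleteSpace A.graph.adjoint :=
  (LinRel.isClosed_adjoint A.graph).completeSpace_coe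

instance (z : ℂ) : CompleteSpace (defect A z) := by
  have : IsClosed (defect A z : Set E) :=
    (LinRel.isClosed_adjoint A.graph).preimage
      (show Continuous fun f : E => (f, z • f) by fun_prop)
  exact this.completeSpace_coe

/-- The boundary maps are continuous in the graph topology of `A*`. -/
theorem continuous_Γ (P : BoundaryTriplet A H) : Continuous (P.Γ₀.prod P.Γ₁) := by
  refine LinearMap.continuous_of_seq_closed_graph _ fun u x y hu hy => ?_
  have key : ∀ g : A.graph.adjoint,
      inner ℂ (P.Γt₀ g) (y.2 - P.Γ₁ x) - inner ℂ (P.Γt₁ g) (y.1 - P.Γ₀ x) = 0 := by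
    intro g
    have l1 : Tendsto (fun n => inner ℂ g.1.1 (u n).1.2 - inner ℂ g.1.2 (u n).1.1) atTop
        (𝓝 (inner ℂ g.1.1 x.1.2 - inner ℂ g.1.2 x.1.1)) :=
      ((show Continuous fun f : A.graph.adjoint =>
        inner ℂ g.1.1 f.1.2 - inner ℂ g.1.2 f.1.1 by fun_prop).tendsto x).comp hu
    have l2 : Tendsto (fun n => inner ℂ (P.Γt₀ g) (P.Γ₁ (u n)) - inner ℂ (P.Γt₁ g) (P.Γ₀ (u n)))
        atTop (𝓝 (inner ℂ (P.Γt₀ g) y.2 - inner ℂ (P.Γt₁ g) y.1)) :=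
      ((show Continuous fun p : H × H =>
        inner ℂ (P.Γt₀ g) p.2 - inner ℂ (P.Γt₁ g) p.1 by fun_prop).tendsto y).comp hy
    simp only [P.green] at l1
    have := tendsto_nhds_unique l1 l2
    rw [inner_sub_right, inner_sub_right]
    linear_combination -this
  obtain ⟨g, hg⟩ := P.surj_t (y.2 - P.Γ₁ x, 0)
  obtain ⟨k, hk⟩ := P.surj_t (0, y.1 - P.Γ₀ x)
  simp only [Prod.mk.injEq] at hg hk
  have h1 := key g
  have h2 := key k
  rw [hg.1, hg.2, inner_zero_left, sub_zero, inner_self_eq_zero, sub_eq_zero] at h1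
  rw [hk.1, hk.2, inner_zero_left, zero_sub, neg_eq_zero, inner_self_eq_zero, sub_eq_zero] at h2
  exact Prod.ext h2 h1

theorem continuous_Γ₀ (P : BoundaryTriplet A H) : Continuous P.Γ₀ :=
  continuous_fst.comp P.continuous_Γ

theorem continuous_Γ₁ (P : BoundaryTriplet A H) : Continuous P.Γ₁ :=
  continuous_snd.comp P.continuous_Γ

/-- The relation `A₀` is closed. -/
theorem isClosed_A₀ (P : BoundaryTriplet A H) : IsClosed (P.A₀ : Set (E × E)) := by
  have h : (P.A₀ : Set (E × E)) = Subtype.val '' (P.Γ₀ ⁻¹' {0}) := by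
    ext x; simp [A₀]
  rw [h]
  exact (LinRel.isClosed_adjoint A.graph).isClosedEmbedding_subtypeVal.isClosedMap _
    (isClosed_singleton.preimage P.continuous_Γ₀)

/-- For `z ∈ ρ(A₀)`, the map `f ↦ Γ₀ {f, z f}` as an isomorphism from `N_z` onto `H`;
its inverse is the `γ`-field. -/
def Γ₀equiv (P : BoundaryTriplet A H) (z : LinRel.resolventSet P.A₀) : defect A z ≃ₗ[ℂ] H :=
  LinearEquiv.ofBijective (P.Γ₀ ∘ₗ hat A z) (P.bijective_Γ₀ z.2)

/-- The Weyl function `M : ρ(A₀) → [H]`: `M(z) h = Γ₁ {f, z f}`, where `f` is the element of `N_z`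
with `Γ₀ {f, z f} = h`. -/
def weyl (P : BoundaryTriplet A H) (z : LinRel.resolventSet P.A₀) : H →L[ℂ] H where
  toLinearMap := (P.Γ₁ ∘ₗ hat A z) ∘ₗ (P.Γ₀equiv z).symm.toLinearMap
  cont := (P.continuous_Γ₁.comp (continuous_hat A z)).comp
    ((P.Γ₀equiv z).continuous_symm (P.continuous_Γ₀.comp (continuous_hat A z)))

/-- `Γ₁ {f, z f} = M(z) Γ₀ {f, z f}` for `f ∈ N_z`, and this determines `M(z)`. -/
theorem eq_weyl_iff (P : BoundaryTriplet A H) (z : LinRel.resolventSet P.A₀) (M : H →L[ℂ] H) :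
    M = P.weyl z ↔ ∀ f : defect A z, P.Γ₁ (hat A z f) = M (P.Γ₀ (hat A z f)) := by
  constructor
  · rintro rfl f
    have h : (P.Γ₀equiv z).symm (P.Γ₀ (hat A z f)) = f := (P.Γ₀equiv z).symm_apply_apply f
    change _ = P.Γ₁ (hat A z ((P.Γ₀equiv z).symm (P.Γ₀ (hat A z f))))
    rw [h]
  · intro h
    ext y
    have h1 := h ((P.Γ₀equiv z).symm y)
    have h2 : P.Γ₀ (hat A z ((P.Γ₀equiv z).symm y)) = y := (P.Γ₀equiv z).apply_symm_apply y
    rw [h2] at h1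
    exact h1.symm

end

section

variable {E₁ : Type*} [NormedAddCommGroup E₁] [InnerProductSpace ℂ E₁] {A₁ : E₁ →ₗ.[ℂ] E₁}
  {E₂ : Type*} [NormedAddCommGroup E₂] [InnerProductSpace ℂ E₂] {A₂ : E₂ →ₗ.[ℂ] E₂}
  {H : Type*} [NormedAddCommGroup H] [InnerProductSpace ℂ H]

/-- Unitary equivalence by means of the unitary `U : E₁ → E₂`, with `Ũ {f, f'} = {U f, U f'}`:
`Ũ A₁* = A₂*`, and the maps `Γ` of the two triplets satisfy `Γ⁽²⁾ Ũ = Γ⁽¹⁾` on `A₁*`. -/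
def UnitarilyEquivalentBy (P₁ : BoundaryTriplet A₁ H) (P₂ : BoundaryTriplet A₂ H)
    (U : E₁ ≃ₗᵢ[ℂ] E₂) : Prop :=
  A₁.graph.adjoint.map (LinearMap.prodMap (U : E₁ →ₗ[ℂ] E₂) (U : E₁ →ₗ[ℂ] E₂)) =
      A₂.graph.adjoint ∧
    ∀ (f : A₁.graph.adjoint) (g : A₂.graph.adjoint), (g : E₂ × E₂) = (U f.1.1, U f.1.2) →
      P₂.Γ₀ g = P₁.Γ₀ f ∧ P₂.Γ₁ g = P₁.Γ₁ f

/-- Unitary equivalence of boundary triplets. -/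
def UnitarilyEquivalent (P₁ : BoundaryTriplet A₁ H) (P₂ : BoundaryTriplet A₂ H) : Prop :=
  ∃ U : E₁ ≃ₗᵢ[ℂ] E₂, UnitarilyEquivalentBy P₁ P₂ U

end

end BoundaryTriplet

end

/-! At the real point `l`, put `T = (A₀ - l)⁻¹` and let `γ` be the value of the γ-field. The `BT`
condition makes `Γ₁ = γ* (f' - l f)` on `A₀`, so `T`, `γ` and `M(l)` determine both `A*` and `Γ`
(`exists_isModel`). It is therefore enough to find a unitary that intertwines the two `T` and the
two `γ`.

Near `l` one has `M(l + w) = M(l) + w γ* (1 - w T)⁻¹ γ`, so the Weyl function determines the moments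
`γ* Tⁿ γ` (`moments_eq`). Since `A₀` need not be self-adjoint, these are not yet the inner products
of the vectors `Tᵐ γ k` and `Tⁿ γ h`. But Green's identity on `A₀` shows that `T* - T` factors
through `γ*` and a skew operator `B`, which the moments for `n = 0, 1` determine (`B_eq`). Moving
powers of `T` across the inner product then expresses every Gram entry by moments (`gram_eq`), and
`Tⁿ γ h ↦ T'ⁿ γ' h` is isometric. Simplicity of `A` and closedness of `ran (A - l)` make these
vectors span a dense subspace (`denseRange_krylov`), so the isometry extends to the required
unitary. -/

namespace BoundaryTriplet

/-! ### The operator model of a boundary triplet at a real point. -/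

section Resolvent

variable {E : Type*} [NormedAddCommGroup E] [InnerProductSpace ℂ E] [CompleteSpace E]
  {A : E →ₗ.[ℂ] E} {H : Type*} [NormedAddCommGroup H] [InnerProductSpace ℂ H] [CompleteSpace H]

/-- For `z ∈ ρ(A₀)` there is a bounded operator `T = (A₀ - z)⁻¹`. -/
theorem exists_resolvent (P : BoundaryTriplet A H) {z : ℂ}
    (hz : z ∈ LinRel.resolventSet P.A₀) :
    ∃ T : E →L[ℂ] E, ∀ f : E × E, f ∈ P.A₀ ↔ f.1 = T (f.2 - z • f.1) := by
  obtain ⟨hk, hr⟩ := hz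
  have : CompleteSpace P.A₀ := P.isClosed_A₀.completeSpace_coe
  let d : P.A₀ →ₗ[ℂ] E := (LinearMap.snd ℂ E E - z • LinearMap.fst ℂ E E) ∘ₗ P.A₀.subtype
  have hd : ∀ f : P.A₀, d f = f.1.2 - z • f.1.1 := fun f => rfl
  have hbij : Function.Bijective d := by
    constructor
    · rw [injective_iff_map_eq_zero]
      intro f hf
      rw [hd, sub_eq_zero] at hf
      have h1 : f.1.1 ∈ LinRel.kerSub P.A₀ z := by
        change (f.1.1, z • f.1.1) ∈ P.A₀
        rw [← hf]
        exact f.2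
      rw [hk, Submodule.mem_bot] at h1
      refine Subtype.ext (Prod.ext h1 ?_)
      rw [hf, h1, smul_zero]
      rfl
    · intro y
      have hy : y ∈ LinRel.ranSub P.A₀ z := by rw [hr]; trivial
      obtain ⟨g, hg, hgy⟩ := hy
      exact ⟨⟨g, hg⟩, hgy⟩
  let e : P.A₀ ≃ₗ[ℂ] E := LinearEquiv.ofBijective d hbij
  have hed : ∀ f, e f = d f := fun f => rfl
  have hcont : Continuous e := by
    change Continuous fun f : P.A₀ => f.1.2 - z • f.1.1
    fun_prop
  refine ⟨⟨LinearMap.fst ℂ E E ∘ₗ P.A₀.subtype ∘ₗ e.symm.toLinearMap,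
    (continuous_fst.comp continuous_subtype_val).comp (e.continuous_symm hcont)⟩, fun f => ?_⟩
  change _ ↔ f.1 = (e.symm (f.2 - z • f.1)).1.1
  constructor
  · intro hf
    have h1 : e.symm (f.2 - z • f.1) = ⟨f, hf⟩ := by
      rw [LinearEquiv.symm_apply_eq]
      rfl
    rw [h1]
  · intro hf
    have h1 := e.apply_symm_apply (f.2 - z • f.1)
    rw [hed, hd, ← hf] at h1
    have h2 : (e.symm (f.2 - z • f.1)).1 = f := Prod.ext hf.symm (sub_left_injective h1)
    rw [← h2]
    exact (e.symm _).2

omit [CompleteSpace E] [CompleteSpace H] in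
/-- The graph of `A` lies in the kernel of the boundary maps. -/
theorem Γ_eq_zero (P : BoundaryTriplet A H) (f : A.graph.adjoint) (hf : (f : E × E) ∈ A.graph) :
    P.Γ₀ f = 0 ∧ P.Γ₁ f = 0 := by
  have key : ∀ g, inner ℂ (P.Γt₀ g) (P.Γ₁ f) - inner ℂ (P.Γt₁ g) (P.Γ₀ f) = 0 := by
    intro g
    rw [← P.green, ← neg_eq_zero, neg_sub]
    have h := (Submodule.mem_adjoint_iff _ _).1 g.2 f.1.1 f.1.2 hf
    have h1 := congrArg (starRingEnd ℂ) h
    rw [map_sub, inner_conj_symm, inner_conj_symm, map_zero] at h1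
    linear_combination -h1
  obtain ⟨g, hg⟩ := P.surj_t (P.Γ₁ f, 0)
  obtain ⟨k, hk⟩ := P.surj_t (0, P.Γ₀ f)
  simp only [Prod.mk.injEq] at hg hk
  have h1 := key g
  have h2 := key k
  rw [hg.1, hg.2, inner_zero_left, sub_zero, inner_self_eq_zero] at h1
  rw [hk.1, hk.2, inner_zero_left, zero_sub, neg_eq_zero, inner_self_eq_zero] at h2
  exact ⟨h2, h1⟩

omit [CompleteSpace E] [CompleteSpace H] in
/-- The kernel of `Γ` is contained in the kernel of `Γᵀ₀`. -/
theorem Γt₀_eq_zero (P : BoundaryTriplet A H) (f : A.graph.adjoint) (h₀ : P.Γ₀ f = 0)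
    (h₁ : P.Γ₁ f = 0) : P.Γt₀ f = 0 := by
  -- With this `g`, Green's form of `g` and `f` is `‖Γt₀ f‖²`, while with the arguments exchanged it
  -- vanishes because `Γ f = 0`.
  obtain ⟨g, hg⟩ := P.surj (0, P.Γt₀ f)
  simp only [Prod.mk.injEq] at hg
  have h2 := P.green g f
  have h3 := congrArg (starRingEnd ℂ) (P.green f g)
  rw [h₀, h₁, inner_zero_right, inner_zero_right, sub_zero, map_sub, inner_conj_symm,
    inner_conj_symm, map_zero] at h3
  rw [hg.1, hg.2, inner_zero_right, sub_zero] at h2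
  rw [← inner_self_eq_zero (𝕜 := ℂ), ← h2]
  linear_combination -h3

/-- The description of a boundary triplet by the resolvent `T = (A₀ - l)⁻¹` and the operator
`γ = γ(l)` at a real point `l`: the elements of `A*` are the pairs `{f, u + l f}`, where
`f = T u + γ h`, and `Γ₀ = h`, `Γ₁ = M h + γ* u` on such a pair. The operator `B` measures how far
`A₀` is from being self-adjoint. -/
structure IsModel (P : BoundaryTriplet A H) (l : ℝ) (T : E →L[ℂ] E) (γ : H →L[ℂ] E)
    (M : H →L[ℂ] H) (B : H →ₗ[ℂ] H) : Prop where
  mem_A₀ : ∀ f : E × E, f ∈ P.A₀ ↔ f.1 = T (f.2 - (l : ℂ) • f.1)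
  mem_defect : ∀ f, f ∈ defect A l ↔ ∃ h, f = γ h
  Γ₀_eq : ∀ (f : A.graph.adjoint) (u : E) (h : H), f.1.1 = T u + γ h →
    f.1.2 = u + (l : ℂ) • f.1.1 → P.Γ₀ f = h
  Γ₁_eq : ∀ (f : A.graph.adjoint) (u : E) (h : H), f.1.1 = T u + γ h →
    f.1.2 = u + (l : ℂ) • f.1.1 → P.Γ₁ f = M h + γ.adjoint u
  mem_adjoint : ∀ f : E × E, f ∈ A.graph.adjoint ↔ ∃ (u : E) (h : H), f.1 = T u + γ h ∧
    f.2 = u + (l : ℂ) • f.1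
  inner_T : ∀ u v, inner ℂ (T v) u - inner ℂ v (T u) = inner ℂ (B (γ.adjoint v)) (γ.adjoint u)
  skew : ∀ h k, inner ℂ (B h) k = - inner ℂ h (B k)

/-- Since `l ∈ ρ(A₀)`, the relation `A*` is the direct sum of `A₀` and the pairs `{γ h, l γ h}`.
Green's identity, applied to these two kinds of elements, gives all the formulas; the terms in `l`
cancel because `l` is real. -/
theorem exists_isModel (P : BoundaryTriplet A H) {l : ℝ} (hP : P.IsBT l) :
    ∃ T γ B, P.IsModel l T γ (P.weyl ⟨l, hP.1⟩) B := by
  obtain ⟨T, hT⟩ := P.exists_resolvent hP.1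
  let z : LinRel.resolventSet P.A₀ := ⟨l, hP.1⟩
  let γ : H →L[ℂ] E := ⟨(defect A l).subtype ∘ₗ (P.Γ₀equiv z).symm.toLinearMap,
    continuous_subtype_val.comp
      ((P.Γ₀equiv z).continuous_symm (P.continuous_Γ₀.comp (continuous_hat A _)))⟩
  have hγdef : ∀ h, γ h = ((P.Γ₀equiv z).symm h : defect A l) := fun h => rfl
  have hγmem : ∀ h, γ h ∈ defect A l := fun h => ((P.Γ₀equiv z).symm h).2
  let G : H → A.graph.adjoint := fun h => hat A l ⟨γ h, hγmem h⟩
  have hG1 : ∀ h, (G h).1.1 = γ h := fun h => rfl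
  have hG2 : ∀ h, (G h).1.2 = (l : ℂ) • γ h := fun h => rfl
  have hG0 : ∀ h, P.Γ₀ (G h) = h := fun h => (P.Γ₀equiv z).apply_symm_apply h
  -- The identity `Γ₀ = Γt₀` on `N_l` enters only here; it lets `Γ₁` on `A₀` be expressed by the
  -- adjoint of the same `γ`.
  have hGt : ∀ h, P.Γt₀ (G h) = h := fun h => (hP.2 ⟨γ h, hγmem h⟩).symm.trans (hG0 h)
  have hGM : ∀ h, P.Γ₁ (G h) = P.weyl z h := fun h => rfl
  have hdef : ∀ f, f ∈ defect A l ↔ ∃ h, f = γ h := by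
    intro f
    constructor
    · intro hf
      refine ⟨P.Γ₀equiv z ⟨f, hf⟩, ?_⟩
      rw [hγdef, LinearEquiv.symm_apply_apply]
    · rintro ⟨h, rfl⟩
      exact hγmem h
  have hΓ₁ : ∀ f : A.graph.adjoint, P.Γ₀ f = 0 →
      P.Γ₁ f = γ.adjoint (f.1.2 - (l : ℂ) • f.1.1) := by
    intro f hf
    refine ext_inner_left ℂ fun k => ?_
    have h1 := P.green f (G k)
    rw [hf, hGt, hG1, hG2, inner_zero_right, sub_zero] at h1
    rw [← h1, ContinuousLinearMap.adjoint_inner_right, inner_sub_right, inner_smul_left,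
      inner_smul_right, Complex.conj_ofReal]
  have hAmem : ∀ u, (T u, u + (l : ℂ) • T u) ∈ P.A₀ := fun u => (hT _).2 (by simp)
  have hle : ∀ f ∈ P.A₀, f ∈ A.graph.adjoint := by
    rintro _ ⟨f, -, rfl⟩
    exact f.2
  let F : E → A.graph.adjoint := fun u => ⟨_, hle _ (hAmem u)⟩
  have hF0 : ∀ u, P.Γ₀ (F u) = 0 := fun u => (P.mem_A₀ _).1 (hAmem u)
  have hF1 : ∀ u, P.Γ₁ (F u) = γ.adjoint u := by
    intro u
    rw [hΓ₁ _ (hF0 u)]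
    change γ.adjoint (u + (l : ℂ) • T u - (l : ℂ) • T u) = _
    rw [add_sub_cancel_right]
  have hdec : ∀ (f : A.graph.adjoint) (u : E) (h : H), f.1.1 = T u + γ h →
      f.1.2 = u + (l : ℂ) • f.1.1 → f = F u + G h := by
    intro f u h h1 h2
    refine Subtype.ext (Prod.ext h1 ?_)
    change f.1.2 = (u + (l : ℂ) • T u) + (l : ℂ) • γ h
    rw [h2, h1, smul_add, add_assoc]
  have hsurj : Function.Surjective (P.Γ₁ ∘ₗ (LinearMap.ker P.Γ₀).subtype) := by
    intro h
    obtain ⟨f, hf⟩ := P.surj (0, h)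
    simp only [Prod.mk.injEq] at hf
    exact ⟨⟨f, hf.1⟩, hf.2⟩
  -- On `ker Γ₀` the value of `Γt₀` depends on `Γ₁` alone, so `B = Γt₀ ∘ s` does not depend on the
  -- choice of the section `s`.
  obtain ⟨s, hs⟩ := LinearMap.exists_rightInverse_of_surjective _ (LinearMap.range_eq_top.2 hsurj)
  have hs1 : ∀ h, P.Γ₁ (s h).1 = h := fun h => LinearMap.congr_fun hs h
  have hs0 : ∀ h, P.Γ₀ (s h).1 = 0 := fun h => (s h).2
  have hB : ∀ v, P.Γt₀ (F v) = P.Γt₀ (s (γ.adjoint v)).1 := by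
    intro v
    rw [← sub_eq_zero, ← map_sub]
    apply P.Γt₀_eq_zero
    · rw [map_sub, hF0, hs0, sub_zero]
    · rw [map_sub, hF1, hs1, sub_self]
  refine ⟨T, γ, P.Γt₀ ∘ₗ (LinearMap.ker P.Γ₀).subtype ∘ₗ s, hT, hdef, ?_, ?_, ?_, ?_, ?_⟩
  · intro f u h h1 h2
    rw [hdec f u h h1 h2, map_add, hF0, hG0, zero_add]
  · intro f u h h1 h2
    rw [hdec f u h h1 h2, map_add, hF1, hGM, add_comm]
  · intro f
    constructor
    · intro hf
      let f' : A.graph.adjoint := ⟨f, hf⟩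
      have h0 : P.Γ₀ (f' - G (P.Γ₀ f')) = 0 := by rw [map_sub, hG0, sub_self]
      have h1 := (hT _).1 ((P.mem_A₀ _).2 h0)
      refine ⟨f.2 - (l : ℂ) • f.1, P.Γ₀ f', ?_, by abel⟩
      have h2 : f.1 - γ (P.Γ₀ f') =
        T (f.2 - (l : ℂ) • γ (P.Γ₀ f') - (l : ℂ) • (f.1 - γ (P.Γ₀ f'))) := h1
      rw [smul_sub, sub_sub_sub_cancel_right] at h2
      rw [← h2, sub_add_cancel]
    · rintro ⟨u, h, h1, h2⟩
      have h3 : f = (F u + G h).1 := by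
        refine Prod.ext h1 ?_
        change f.2 = (u + (l : ℂ) • T u) + (l : ℂ) • γ h
        rw [h2, h1, smul_add, add_assoc]
      rw [h3]
      exact (F u + G h).2
  · intro u v
    have h1 := P.green (F u) (F v)
    rw [hF0, hF1, inner_zero_right, sub_zero, hB] at h1
    change inner ℂ (T v) (u + (l : ℂ) • T u) - inner ℂ (v + (l : ℂ) • T v) (T u) = _ at h1
    rw [inner_add_right, inner_add_left, inner_smul_left, inner_smul_right,
      Complex.conj_ofReal] at h1
    change _ = inner ℂ (P.Γt₀ (s (γ.adjoint v)).1) (γ.adjoint u)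
    rw [← h1]
    ring
  · intro h k
    -- Exchanging the arguments of Green's form and conjugating reverses its sign; hence `B` is
    -- skew.
    have h1 := P.green (s k).1 (s h).1
    have h2 := congrArg (starRingEnd ℂ) (P.green (s h).1 (s k).1)
    rw [hs0, hs1, inner_zero_right, sub_zero] at h1 h2
    rw [map_sub] at h2
    simp only [inner_conj_symm] at h2
    change inner ℂ (P.Γt₀ (s h).1) k = - inner ℂ h (P.Γt₀ (s k).1)
    rw [← h1, ← h2]
    ring

/-! ### Neumann series and the expansion of the Weyl function. -/

namespace IsModel

variable {P : BoundaryTriplet A H} {l : ℝ} {T : E →L[ℂ] E} {γ : H →L[ℂ] E}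
  {M : H →L[ℂ] H} {B : H →ₗ[ℂ] H}

theorem injective_γ (hP : P.IsModel l T γ M B) {h : H} (hh : γ h = 0) : h = 0 := by
  have h1 := hP.Γ₀_eq 0 0 h (by simp [hh]) (by simp)
  rw [map_zero] at h1
  exact h1.symm

/-- Inverting `1 - w T` by the Neumann series solves `(A₀ - l - w) f = y`. Thus a full neighbourhood
of `l` lies in `ρ(A₀)`, and the Weyl functions can be compared as power series. -/
theorem mem_resolventSet (hP : P.IsModel l T γ M B) {w : ℂ} (hw : ‖w • T‖ < 1) :
    (l : ℂ) + w ∈ LinRel.resolventSet P.A₀ := by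
  constructor
  · rw [eq_bot_iff]
    intro f hf
    have h1 := (hP.mem_A₀ _).1 hf
    have h2 : f = T (((l : ℂ) + w) • f - (l : ℂ) • f) := h1
    rw [add_smul, add_sub_cancel_left, map_smul] at h2
    have h3 := congrArg (fun S : E →L[ℂ] E => S f) (geom_series_mul_neg (w • T) hw)
    have h4 : (1 - w • T) f = 0 := by
      change f - w • T f = 0
      rw [← h2, sub_self]
    simp only [mul_apply_eq_comp, h4, map_zero] at h3
    exact h3.symm
  · rw [eq_top_iff]
    intro y _
    let v := (∑' i, (w • T) ^ i) y
    have h3 : (1 - w • T) v = y :=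
      congrArg (fun S : E →L[ℂ] E => S y) (mul_neg_geom_series (w • T) hw)
    have h4 : v - w • T v = y := h3
    refine ⟨(T v, v + (l : ℂ) • T v), (hP.mem_A₀ _).2 (by simp), ?_⟩
    change v + (l : ℂ) • T v - ((l : ℂ) + w) • T v = y
    rw [← h4, add_smul]
    abel

/-- An element of `N_{l+w}` has model coordinate `u = w f`, so `(1 - w T) f = γ k` and `f` is a
Neumann series in `γ k`. -/
theorem weyl_eq (hP : P.IsModel l T γ M B) {w : ℂ} (hw : ‖w • T‖ < 1)
    (hz : (l : ℂ) + w ∈ LinRel.resolventSet P.A₀) (h : H) :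
    P.weyl ⟨_, hz⟩ h = M h + w • γ.adjoint ((∑' i, (w • T) ^ i) (γ h)) := by
  have key := (P.eq_weyl_iff ⟨_, hz⟩ (M + w • (γ.adjoint ∘L (∑' i, (w • T) ^ i) ∘L γ))).2 ?_
  · rw [← key]
    rfl
  · intro f
    obtain ⟨u, k, h1, h2⟩ := (hP.mem_adjoint _).1 (hat A _ f).2
    rw [hP.Γ₀_eq _ u k h1 h2, hP.Γ₁_eq _ u k h1 h2]
    have h1' : f.1 = T u + γ k := h1
    have h2' : ((l : ℂ) + w) • f.1 = u + (l : ℂ) • f.1 := h2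
    have hu : u = w • f.1 := by
      rw [add_smul, add_comm] at h2'
      exact (add_right_cancel h2').symm
    have h4 : (1 - w • T) f.1 = γ k := by
      change f.1 - w • T f.1 = γ k
      nth_rw 1 [h1']
      rw [hu, map_smul, add_sub_cancel_left]
    have h3 := congrArg (fun S : E →L[ℂ] E => S f.1) (geom_series_mul_neg (w • T) hw)
    simp only [mul_apply_eq_comp, h4] at h3
    change _ = M k + w • γ.adjoint ((∑' i, (w • T) ^ i) (γ k))
    rw [h3, hu, map_smul]
    rfl

/-- The power series of the Weyl function at `l`. -/
theorem hasSum_weyl (hP : P.IsModel l T γ M B) {w : ℂ} (hw : ‖w • T‖ < 1)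
    (hz : (l : ℂ) + w ∈ LinRel.resolventSet P.A₀) (h k : H) :
    HasSum (fun n : ℕ => w ^ n • (Nat.casesOn n (inner ℂ k (M h))
      fun n => inner ℂ (γ k) ((T ^ n) (γ h)) : ℂ)) (inner ℂ k (P.weyl ⟨_, hz⟩ h)) := by
  have h1 := (summable_geometric_of_norm_lt_one hw).hasSum
  have h2 := (h1.mapL ((w • innerSL ℂ (γ k)) ∘L ContinuousLinearMap.apply ℂ E (γ h)))
  -- The term `n = 0` is `M(l)`; the extra factor `w` shifts the moment of order `n` to the
  -- coefficient of order `n + 1`.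
  rw [← hasSum_nat_add_iff' 1]
  convert! h2 using 1
  · funext n
    change w ^ (n + 1) * inner ℂ (γ k) ((T ^ n) (γ h)) = w * inner ℂ (γ k) (((w • T) ^ n) (γ h))
    rw [smul_pow, smul_apply, inner_smul_right, pow_succ]
    ring
  · rw [hP.weyl_eq hw hz]
    change _ = w * inner ℂ (γ k) ((∑' i, (w • T) ^ i) (γ h))
    simp [ContinuousLinearMap.adjoint_inner_right]

end IsModel

end Resolvent
end BoundaryTriplet

namespace BoundaryTriplet

/-! ### Moments, the skew operator and the Gram matrix. -/

section Moments

variable {E : Type*} [NormedAddCommGroup E] [InnerProductSpace ℂ E] [CompleteSpace E]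
  {H : Type*} [NormedAddCommGroup H] [InnerProductSpace ℂ H] [CompleteSpace H]

/-- The linear map with `h zⁿ ↦ Tⁿ γ h`. -/
noncomputable def krylov (T : E →L[ℂ] E) (γ : H →L[ℂ] E) : (ℕ →₀ H) →ₗ[ℂ] E :=
  Finsupp.lsum ℂ fun n => ((T ^ n) ∘L γ : H →L[ℂ] E).toLinearMap

omit [CompleteSpace E] [CompleteSpace H] in
theorem krylov_single (T : E →L[ℂ] E) (γ : H →L[ℂ] E) (n : ℕ) (h : H) :
    krylov T γ (Finsupp.single n h) = (T ^ n) (γ h) := by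
  rw [krylov, Finsupp.lsum_single]
  rfl

variable {A : E →ₗ.[ℂ] E} {P : BoundaryTriplet A H} {l : ℝ} {T : E →L[ℂ] E} {γ : H →L[ℂ] E}
  {M : H →L[ℂ] H} {B : H →ₗ[ℂ] H}

theorem IsModel.eq_zero_of_orthogonal (hP : P.IsModel l T γ M B) {x : H}
    (hx : ∀ k, inner ℂ (γ x) (γ k) = 0) : x = 0 :=
  hP.injective_γ (inner_self_eq_zero.1 (hx x))

variable {E' : Type*} [NormedAddCommGroup E'] [InnerProductSpace ℂ E'] [CompleteSpace E']
  {A' : E' →ₗ.[ℂ] E'} {P' : BoundaryTriplet A' H} {T' : E' →L[ℂ] E'} {γ' : H →L[ℂ] E'}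
  {M' : H →L[ℂ] H} {B' : H →ₗ[ℂ] H}

omit [CompleteSpace E] in
theorem eventually_norm_smul_lt_one (S : E →L[ℂ] E) : ∀ᶠ w : ℂ in 𝓝 0, ‖w • S‖ < 1 := by
  have hc : Continuous fun w : ℂ => ‖w • S‖ := by fun_prop
  exact hc.continuousAt.eventually_lt continuousAt_const (by simp)

/-- Both expansions represent one function near `0`, so uniqueness of power series coefficients
applies. -/
theorem IsModel.moments_eq (hP : P.IsModel l T γ M B) (hP' : P'.IsModel l T' γ' M' B')
    {ε : ℝ} (hε : 0 < ε)
    (hM : ∀ (z : ℂ) (h₁ : z ∈ LinRel.resolventSet P.A₀) (h₂ : z ∈ LinRel.resolventSet P'.A₀),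
      ‖z - (l : ℂ)‖ < ε → P.weyl ⟨z, h₁⟩ = P'.weyl ⟨z, h₂⟩) (n : ℕ) (h k : H) :
    inner ℂ (γ k) ((T ^ n) (γ h)) = inner ℂ (γ' k) ((T' ^ n) (γ' h)) := by
  let F : ℂ → ℂ := fun w => inner ℂ k (M h + w • γ.adjoint ((∑' i, (w • T) ^ i) (γ h)))
  have hF : HasFPowerSeriesAt F (FormalMultilinearSeries.ofScalars ℂ fun n : ℕ =>
      (Nat.casesOn n (inner ℂ k (M h)) fun n => inner ℂ (γ k) ((T ^ n) (γ h)) : ℂ)) 0 := by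
    rw [hasFPowerSeriesAt_iff]
    filter_upwards [eventually_norm_smul_lt_one T] with w hw
    simp only [FormalMultilinearSeries.coeff_ofScalars, zero_add]
    have := hP.hasSum_weyl hw (hP.mem_resolventSet hw) h k
    rwa [hP.weyl_eq hw] at this
  have hF' : HasFPowerSeriesAt F (FormalMultilinearSeries.ofScalars ℂ fun n : ℕ =>
      (Nat.casesOn n (inner ℂ k (M' h)) fun n => inner ℂ (γ' k) ((T' ^ n) (γ' h)) : ℂ)) 0 := by
    rw [hasFPowerSeriesAt_iff]
    filter_upwards [eventually_norm_smul_lt_one T, eventually_norm_smul_lt_one T', Metric.ball_mem_nhds 0 hε] with w hw hw' hwε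
    simp only [FormalMultilinearSeries.coeff_ofScalars, zero_add]
    have h1 := hP'.hasSum_weyl hw' (hP'.mem_resolventSet hw') h k
    rwa [← hM _ (hP.mem_resolventSet hw) (hP'.mem_resolventSet hw') (by simpa using hwε),
      hP.weyl_eq hw] at h1
  have h1 := congrArg (fun p => FormalMultilinearSeries.coeff p (n + 1))
    (hF.eq_formalMultilinearSeries hF')
  simpa only [FormalMultilinearSeries.coeff_ofScalars] using h1

/-- The moments for `n = 0, 1` give the form of `B` on the range of `γ* γ`. As `γ` is injective,
nothing nonzero is orthogonal to this range, so testing first one argument and then, by skewness,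
the other determines `B`. -/
theorem IsModel.B_eq (hP : P.IsModel l T γ M B) (hP' : P'.IsModel l T' γ' M' B')
    (hm : ∀ (n : ℕ) (h k : H),
      inner ℂ (γ k) ((T ^ n) (γ h)) = inner ℂ (γ' k) ((T' ^ n) (γ' h))) : B = B' := by
  have h0 : ∀ h k, inner ℂ (γ k) (γ h) = inner ℂ (γ' k) (γ' h) := hm 0
  have h1 : ∀ h k, inner ℂ (γ k) (T (γ h)) = inner ℂ (γ' k) (T' (γ' h)) := fun h k => by
    simpa using hm 1 h k
  have hC : ∀ h, γ.adjoint (γ h) = γ'.adjoint (γ' h) := fun h =>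
    ext_inner_left ℂ fun k => by
      rw [ContinuousLinearMap.adjoint_inner_right, ContinuousLinearMap.adjoint_inner_right, h0]
  have h2 : ∀ h, B (γ.adjoint (γ h)) = B' (γ.adjoint (γ h)) := by
    intro h
    rw [← sub_eq_zero]
    refine hP.eq_zero_of_orthogonal fun k => ?_
    rw [← ContinuousLinearMap.adjoint_inner_right, inner_sub_left, ← hP.inner_T, hC h, hC k,
      ← hP'.inner_T, h1, ← inner_conj_symm (T (γ h)), ← inner_conj_symm (T' (γ' h)), h1, sub_self]
  refine LinearMap.ext fun h => ?_
  rw [← sub_eq_zero]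
  refine hP.eq_zero_of_orthogonal fun k => ?_
  rw [← ContinuousLinearMap.adjoint_inner_right, inner_sub_left, hP.skew, hP'.skew, h2, sub_self]

/-- Each power of `T` on the left moves to the right at the cost of `inner (B (γ* Tᵐ γ k)) (γ* Tⁿ γ
h)`, which contains only moments and `B`. -/
theorem IsModel.gram_eq (hP : P.IsModel l T γ M B) (hP' : P'.IsModel l T' γ' M' B')
    (hm : ∀ (n : ℕ) (h k : H),
      inner ℂ (γ k) ((T ^ n) (γ h)) = inner ℂ (γ' k) ((T' ^ n) (γ' h))) (m n : ℕ) (h k : H) :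
    inner ℂ ((T ^ m) (γ k)) ((T ^ n) (γ h)) = inner ℂ ((T' ^ m) (γ' k)) ((T' ^ n) (γ' h)) := by
  have hC : ∀ n h, γ.adjoint ((T ^ n) (γ h)) = γ'.adjoint ((T' ^ n) (γ' h)) := fun n h =>
    ext_inner_left ℂ fun k => by
      rw [ContinuousLinearMap.adjoint_inner_right, ContinuousLinearMap.adjoint_inner_right, hm]
  induction m generalizing n with
  | zero => exact hm n h k
  | succ m ih =>
    rw [pow_succ', pow_succ', mul_apply_eq_comp, mul_apply_eq_comp,
      sub_eq_iff_eq_add.1 (hP.inner_T _ _), sub_eq_iff_eq_add.1 (hP'.inner_T _ _), hC, hC,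
      hP.B_eq hP' hm, ← mul_apply_eq_comp, ← mul_apply_eq_comp, ← pow_succ', ← pow_succ', ih]

theorem IsModel.norm_krylov_eq (hP : P.IsModel l T γ M B) (hP' : P'.IsModel l T' γ' M' B')
    (hm : ∀ (n : ℕ) (h k : H),
      inner ℂ (γ k) ((T ^ n) (γ h)) = inner ℂ (γ' k) ((T' ^ n) (γ' h))) (x : ℕ →₀ H) :
    ‖krylov T' γ' x‖ = ‖krylov T γ x‖ := by
  have key : ∀ x y, inner ℂ (krylov T' γ' x) (krylov T' γ' y) =
      inner ℂ (krylov T γ x) (krylov T γ y) := by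
    intro x y
    induction x using Finsupp.induction_linear with
    | zero => simp
    | add x₁ x₂ h₁ h₂ => simp only [map_add, inner_add_left, h₁, h₂]
    | single m k =>
      induction y using Finsupp.induction_linear with
      | zero => simp
      | add y₁ y₂ h₁ h₂ => simp only [map_add, inner_add_right, h₁, h₂]
      | single n h => simp only [krylov_single, hP.gram_eq hP' hm]
  rw [norm_eq_sqrt_re_inner (𝕜 := ℂ), key, ← norm_eq_sqrt_re_inner (𝕜 := ℂ)]

end Moments

/-! ### Simplicity and density of the Krylov span. -/

section Simple

variable {E : Type*} [NormedAddCommGroup E] [InnerProductSpace ℂ E] [CompleteSpace E]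
  {H : Type*} [NormedAddCommGroup H] [InnerProductSpace ℂ H] [CompleteSpace H]
  {A : E →ₗ.[ℂ] E} {P : BoundaryTriplet A H} {l : ℝ} {T : E →L[ℂ] E} {γ : H →L[ℂ] E}
  {M : H →L[ℂ] H} {B : H →ₗ[ℂ] H}

omit [CompleteSpace E] in
/-- The part of the graph of `A` in a subspace. -/
theorem exists_part (A : E →ₗ.[ℂ] E) (K : Submodule ℂ E) :
    ∃ A₁ : K →ₗ.[ℂ] K, ∀ f : K × K, f ∈ A₁.graph ↔ ((f.1 : E), (f.2 : E)) ∈ A.graph := by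
  let g : Submodule ℂ (K × K) := A.graph.comap (LinearMap.prodMap K.subtype K.subtype)
  refine ⟨g.toLinearPMap, fun f => ?_⟩
  rw [Submodule.toLinearPMap_graph_eq]
  · rfl
  · intro x hx hx0
    refine Subtype.ext (A.graph_fst_eq_zero_snd hx ?_)
    change ((x.1 : K) : E) = 0
    rw [hx0]
    rfl

/-- On the orthogonal complement `K` of the span, `γ*` vanishes, so `T` is symmetric there and
leaves `K` invariant. As `K ⊥ N_l` and `ran (A - l)` is closed, `T` on `K` inverts a part of `A -
l`. That part of `A` is self-adjoint and splits off, which simplicity forbids unless `K = 0`. -/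
theorem IsModel.denseRange_krylov (hP : P.IsModel l T γ M B) (hsymm : LinRel.IsSymm A.graph)
    (hsimple : LinRel.IsSimple A) (hreg : (l : ℂ) ∈ LinRel.regularTypePoints A.graph) :
    DenseRange (krylov T γ) := by
  set K : Submodule ℂ E := (LinearMap.range (krylov T γ))ᗮ with hK
  suffices h : K = ⊥ by
    have h1 := Submodule.dense_iff_topologicalClosure_eq_top.2
      ((Submodule.topologicalClosure_eq_top_iff (K := LinearMap.range (krylov T γ))).2 h)
    rwa [LinearMap.coe_range] at h1
  by_contra hne
  refine hsimple ?_
  have hKmem : ∀ u, u ∈ K ↔ ∀ n h, inner ℂ ((T ^ n) (γ h)) u = 0 := by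
    intro u
    rw [hK, Submodule.mem_orthogonal]
    constructor
    · intro h n k
      exact h _ ⟨_, krylov_single T γ n k⟩
    · rintro h _ ⟨x, rfl⟩
      induction x using Finsupp.induction_linear with
      | zero => simp
      | add x₁ x₂ h₁ h₂ => rw [map_add, inner_add_left, h₁, h₂, add_zero]
      | single n k => rw [krylov_single, h]
  have hγK : ∀ u ∈ K, γ.adjoint u = 0 := fun u hu => ext_inner_left ℂ fun k => by
    rw [ContinuousLinearMap.adjoint_inner_right, inner_zero_right]
    exact (hKmem u).1 hu 0 k
  have hTsymm : ∀ u ∈ K, ∀ v, inner ℂ (T v) u = inner ℂ v (T u) := by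
    intro u hu v
    rw [← sub_eq_zero, hP.inner_T, hγK u hu, inner_zero_right]
  have hTK : ∀ u ∈ K, T u ∈ K := by
    intro u hu
    rw [hKmem]
    intro n h
    rw [← hTsymm u hu, ← mul_apply_eq_comp, ← pow_succ']
    exact (hKmem u).1 hu _ _
  have hAT : ∀ f ∈ A.graph, f.1 = T (f.2 - (l : ℂ) • f.1) := by
    intro f hf
    rw [← hP.mem_A₀]
    exact (P.mem_A₀ ⟨f, hsymm hf⟩).2 (P.Γ_eq_zero _ hf).1
  have hTA : ∀ u ∈ K, (T u, u + (l : ℂ) • T u) ∈ A.graph := by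
    intro u hu
    have hcl : ((LinRel.ranSub A.graph l)ᗮ)ᗮ = LinRel.ranSub A.graph l := by
      rw [Submodule.orthogonal_orthogonal_eq_closure]
      exact hreg.2.1.submodule_topologicalClosure_eq
    have hu' : u ∈ LinRel.ranSub A.graph l := by
      rw [← hcl, Submodule.mem_orthogonal]
      intro g hg
      have hgd : g ∈ defect A l := by
        change (g, (l : ℂ) • g) ∈ A.graph.adjoint
        rw [Submodule.mem_adjoint_iff]
        intro a b hab
        have h1 := (Submodule.mem_orthogonal _ _).1 hg (b - (l : ℂ) • a) ⟨(a, b), hab, rfl⟩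
        rw [inner_sub_left, inner_smul_left, Complex.conj_ofReal] at h1
        rw [inner_smul_right]
        exact h1
      obtain ⟨h, rfl⟩ := (hP.mem_defect g).1 hgd
      exact (hKmem u).1 hu 0 h
    obtain ⟨f, hf, hfu⟩ := hu'
    have hfu' : f.2 - (l : ℂ) • f.1 = u := hfu
    have h1 := hAT f hf
    rw [hfu'] at h1
    have h2 : f = (T u, u + (l : ℂ) • T u) := by
      refine Prod.ext h1 ?_
      rw [← h1, ← hfu', sub_add_cancel]
    rw [← h2]
    exact hf
  obtain ⟨A₁, hA₁⟩ := exists_part A K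
  obtain ⟨A₂, hA₂⟩ := exists_part A Kᗮ
  have hKcl : IsClosed (K : Set E) := Submodule.isClosed_orthogonal _
  have : CompleteSpace K := hKcl.completeSpace_coe
  refine ⟨K, A₁, A₂, hKcl, hne, ?_, ?_, ?_⟩
  · apply le_antisymm
    · rintro f hf
      rw [Submodule.mem_adjoint_iff]
      intro a b hab
      exact (Submodule.mem_adjoint_iff _ _).1 (hsymm ((hA₁ f).1 hf)) a b ((hA₁ _).1 hab)
    · intro f hf
      rw [Submodule.mem_adjoint_iff] at hf
      have hv : (f.2 : E) - (l : ℂ) • (f.1 : E) ∈ K := K.sub_mem f.2.2 (K.smul_mem _ f.1.2)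
      -- Testing `f ∈ A₁*` against `{T x, x + l T x} ∈ A₁`, with `x` the defect in this equation,
      -- yields `(x, x) = 0`.
      have key : (f.1 : E) = T ((f.2 : E) - (l : ℂ) • (f.1 : E)) := by
        rw [← sub_eq_zero, ← inner_self_eq_zero (𝕜 := ℂ)]
        set x : E := (f.1 : E) - T ((f.2 : E) - (l : ℂ) • (f.1 : E)) with hx
        have hxK : x ∈ K := K.sub_mem f.1.2 (hTK _ hv)
        have h1 : inner ℂ (x + (l : ℂ) • T x) (f.1 : E) - inner ℂ (T x) (f.2 : E) = 0 :=
          hf ⟨T x, hTK _ hxK⟩ ⟨x + (l : ℂ) • T x, K.add_mem hxK (K.smul_mem _ (hTK _ hxK))⟩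
            ((hA₁ _).2 (hTA x hxK))
        have h2 := hTsymm _ hv x
        rw [inner_add_left, inner_smul_left, Complex.conj_ofReal] at h1
        rw [inner_sub_right, inner_smul_right] at h2
        nth_rw 2 [hx]
        rw [inner_sub_right, ← h2]
        linear_combination h1
      rw [hA₁]
      have h1 := hTA _ hv
      rwa [← key, sub_add_cancel] at h1
  · intro f hf
    rw [Submodule.mem_adjoint_iff]
    intro a b hab
    exact (Submodule.mem_adjoint_iff _ _).1 (hsymm ((hA₂ f).1 hf)) a b ((hA₂ _).1 hab)
  · apply le_antisymm
    · intro f hf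
      set y := f.2 - (l : ℂ) • f.1 with hy
      -- Splitting `(A - l) f` along `K ⊕ Kᗮ` splits `f` itself, since symmetry of `T` against `K`
      -- also keeps `Kᗮ` invariant.
      obtain ⟨v, hv, y', hy', hyv⟩ := K.exists_add_mem_mem_orthogonal y
      have hf1 := hAT f hf
      rw [← hy, hyv, map_add] at hf1
      have hTy' : T y' ∈ Kᗮ := by
        rw [Submodule.mem_orthogonal']
        intro w hw
        rw [hTsymm w hw]
        exact Submodule.inner_left_of_mem_orthogonal (hTK w hw) hy'
      have hf2 : f = (T v, v + (l : ℂ) • T v) + (T y', y' + (l : ℂ) • T y') := by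
        refine Prod.ext hf1 ?_
        change f.2 = v + (l : ℂ) • T v + (y' + (l : ℂ) • T y')
        rw [add_add_add_comm, ← hyv, ← smul_add, ← hf1, hy, sub_add_cancel]
      have hm2 : (T y', y' + (l : ℂ) • T y') ∈ A.graph := by
        rw [eq_sub_of_add_eq' hf2.symm]
        exact A.graph.sub_mem hf (hTA v hv)
      rw [hf2]
      refine Submodule.add_mem_sup ?_ ?_
      · exact ⟨(⟨T v, hTK v hv⟩, ⟨_, K.add_mem hv (K.smul_mem _ (hTK v hv))⟩),
          (hA₁ _).2 (hTA v hv), rfl⟩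
      · exact ⟨(⟨T y', hTy'⟩, ⟨_, Kᗮ.add_mem hy' (Kᗮ.smul_mem _ hTy')⟩), (hA₂ _).2 hm2, rfl⟩
    · rw [sup_le_iff]
      constructor
      · rintro _ ⟨x, hx, rfl⟩
        exact (hA₁ x).1 hx
      · rintro _ ⟨x, hx, rfl⟩
        exact (hA₂ x).1 hx

end Simple
end BoundaryTriplet

/-! ### The intertwining unitary. -/

theorem theorem4p6
    {E₁ E₂ H : Type*}
    [NormedAddCommGroup E₁] [InnerProductSpace ℂ E₁] [CompleteSpace E₁]
    [NormedAddCommGroup E₂] [InnerProductSpace ℂ E₂] [CompleteSpace E₂]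
    [NormedAddCommGroup H] [InnerProductSpace ℂ H] [CompleteSpace H]
    (A₁ : E₁ →ₗ.[ℂ] E₁) (A₂ : E₂ →ₗ.[ℂ] E₂)
    (hcl₁ : A₁.IsClosed) (hcl₂ : A₂.IsClosed)
    (hsymm₁ : LinRel.IsSymm A₁.graph) (hsymm₂ : LinRel.IsSymm A₂.graph)
    (hsimple₁ : LinRel.IsSimple A₁) (hsimple₂ : LinRel.IsSimple A₂)
    (l₀ : ℝ)
    (hreg₁ : (l₀ : ℂ) ∈ LinRel.regularTypePoints A₁.graph)
    (hreg₂ : (l₀ : ℂ) ∈ LinRel.regularTypePoints A₂.graph)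
    (P₁ : BoundaryTriplet A₁ H) (P₂ : BoundaryTriplet A₂ H)
    (hBT₁ : P₁.IsBT l₀) (hBT₂ : P₂.IsBT l₀)
    (ε : ℝ) (hε : 0 < ε)
    (hM : ∀ (z : ℂ) (h₁ : z ∈ LinRel.resolventSet P₁.A₀) (h₂ : z ∈ LinRel.resolventSet P₂.A₀),
      ‖z - (l₀ : ℂ)‖ < ε → P₁.weyl ⟨z, h₁⟩ = P₂.weyl ⟨z, h₂⟩) :
    BoundaryTriplet.UnitarilyEquivalent P₁ P₂ := by
  obtain ⟨T₁, γ₁, B₁, m₁⟩ := P₁.exists_isModel hBT₁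
  obtain ⟨T₂, γ₂, B₂, m₂⟩ := P₂.exists_isModel hBT₂
  have hM₀ := hM l₀ hBT₁.1 hBT₂.1 (by simpa using hε)
  have hm := m₁.moments_eq m₂ hε hM
  have d₁ := m₁.denseRange_krylov hsymm₁ hsimple₁ hreg₁
  have d₂ := m₂.denseRange_krylov hsymm₂ hsimple₂ hreg₂
  -- Both Krylov maps start from `ℕ →₀ H`, have dense range and give equal norms, so the identity of
  -- `ℕ →₀ H` induces a unitary.
  let U : E₁ ≃ₗᵢ[ℂ] E₂ := (LinearEquiv.refl ℂ (ℕ →₀ H)).extendOfIsometry _ _ d₁ d₂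
    (m₁.norm_krylov_eq m₂ hm)
  have hU : ∀ x, U (BoundaryTriplet.krylov T₁ γ₁ x) = BoundaryTriplet.krylov T₂ γ₂ x :=
    fun x => LinearEquiv.extendOfIsometry_eq _ _ _ d₁ d₂ _ x
  have hUp : ∀ n h, U ((T₁ ^ n) (γ₁ h)) = (T₂ ^ n) (γ₂ h) := fun n h => by
    rw [← BoundaryTriplet.krylov_single, hU, BoundaryTriplet.krylov_single]
  have hUγ : ∀ h, U (γ₁ h) = γ₂ h := hUp 0
  have hUT : ∀ x, U (T₁ x) = T₂ (U x) := by
    refine fun x => d₁.induction_on (p := fun x => U (T₁ x) = T₂ (U x)) x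
      (isClosed_eq (by fun_prop) (by fun_prop)) fun y => ?_
    induction y using Finsupp.induction_linear with
    | zero => simp
    | add y₁ y₂ h₁ h₂ => simp only [map_add, h₁, h₂]
    | single n h =>
      rw [BoundaryTriplet.krylov_single, hUp, ← mul_apply_eq_comp, ← mul_apply_eq_comp,
        ← pow_succ', ← pow_succ', hUp]
  have hUadj : ∀ u, γ₂.adjoint (U u) = γ₁.adjoint u := fun u => ext_inner_left ℂ fun k => by
    rw [ContinuousLinearMap.adjoint_inner_right, ContinuousLinearMap.adjoint_inner_right,
      ← hUγ, U.inner_map_map]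
  have hUsymm : ∀ h, U.symm (γ₂ h) = γ₁ h := fun h => by rw [← hUγ, U.symm_apply_apply]
  refine ⟨U, ?_, ?_⟩
  · ext g
    rw [m₂.mem_adjoint]
    constructor
    · rintro ⟨f, hf, rfl⟩
      obtain ⟨u, h, h1, h2⟩ := (m₁.mem_adjoint f).1 hf
      refine ⟨U u, h, ?_, ?_⟩
      · change U f.1 = _
        rw [h1, map_add, hUT, hUγ]
      · change U f.2 = _ + _ • U f.1
        rw [h2, map_add, map_smul]
    · rintro ⟨u, h, h1, h2⟩
      refine ⟨(U.symm g.1, U.symm g.2), (m₁.mem_adjoint _).2 ⟨U.symm u, h, ?_, ?_⟩, ?_⟩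
      · apply U.injective
        rw [map_add, hUT, hUγ, U.apply_symm_apply, U.apply_symm_apply, h1]
      · change U.symm g.2 = U.symm u + _ • U.symm g.1
        rw [h2, map_add, map_smul]
      · exact Prod.ext (U.apply_symm_apply _) (U.apply_symm_apply _)
  · intro f g hfg
    obtain ⟨u, h, h1, h2⟩ := (m₁.mem_adjoint f).1 f.2
    have g1 : g.1.1 = T₂ (U u) + γ₂ h := by
      rw [hfg, ← hUT, ← hUγ, ← map_add, h1]
    have g2 : g.1.2 = U u + (l₀ : ℂ) • g.1.1 := by
      rw [hfg, ← map_smul, ← map_add, h2]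
    rw [m₁.Γ₀_eq f u h h1 h2, m₂.Γ₀_eq g _ h g1 g2, m₁.Γ₁_eq f u h h1 h2,
      m₂.Γ₁_eq g _ h g1 g2, hUadj, hM₀]
    exact ⟨rfl, rfl⟩
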